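/- **Setting.** An election has candidates $C=\{1,\dots,m\}$, voters $V=\{1,\dots,n\}$, a committee size $k$ with $2\le k<m$, and ballots $u_i:C\to\mathbb R_{\ge 0}$, extended additively by $u_i(W)=\sum_{c\in W}u_i(c)$. It is *single-approval* if every voter $i$ has at most one candidate $c$ with $u_i(c)>0$. A nonempty set $S\subseteq V$ is $(\alpha,T)$-*cohesive*, for $\alpha:C\to\mathbb R_{\ge0}$ and $T\subseteq C$, if $|S|/n\ge |T|/k$ and $u_i(c)\ge\alpha(c)$ for all $i\in S$, $c\in T$. A committee $W$ satisfies *EJR up to $p$ candidates* if for every $(\alpha,T)$-cohesive $S$ there are $i\in S$ and $X\subseteq C$ with $|X|\le p$ and $u_i(W\cup X)\ge\sum_{c\in T}\alpha(c)$; *EJR* is the case $X=\emptyset$. **MES.** For $X\subseteq C$, the Method of Equal Shares on the restriction of the election to $X$ gives each of the $n$ voters the budget $k/n$. It repeatedly buys, at cost $1$, a candidate $c\in X$ not yet bought that is $\rho$-affordable, i.e. $\sum_i\min(b_i,\rho\,u_i(c))=1$ for the remaining budgets $b_i$, with the smallest possible $\rho\ge 0$; voter $i$ pays $\min(b_i,\rho\,u_i(c))$.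 When no candidate is affordable, the outcome is completed to $\min(k,|X|)$ members by adding the remaining candidates of $X$ in decreasing order of a fixed score $C\to\mathbb R$ (total utility, for instance). All ties are broken by a fixed order of the candidates. Score and tie-breaking order are arbitrary, but do not depend on the arrival order. **Online MES with threshold $t$.** Let $C_S$ be the first $t$ candidates to arrive and $C_R=\mathrm{MES}(C_S)$; put $R=C_R$ and $W=\emptyset$. For each later candidate $c$ in arrival order: if $k-|W|$ equals the number of candidates still to come ($c$ included), hire all of these and stop. Otherwise compute $W'=\mathrm{MES}(R\cup\{c\})$. If some $\hat c\in R\setminus W'$ belongs to $C_R$, hire $c$ (add it to $W$). Whenever $c\in W'$, hired or not, replace $R$ by $(R\cup\{c\})\setminus(R\setminus W')$. Stop as soon as $|W|=k$. The outcome is $W$. **Theorem.** 1. For every election, threshold $t$ and arrival order, Online MES returns a committee with at most $k$ members, and with exactly $k$ members whenever $t+k\le m$ (in particular for $t=\lfloor m/e\rfloor$ when $t\ge k$). 2. Let $t=\lfloor m/e\rfloor$ and let the candidates arrive in a uniformly random order. For all integers $0\le p<k$ with $k\ge 2$ and every $\varepsilon>0$ there is an $M$ such that for all $m\ge M$, all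 $n$ and all single-approval elections with $m$ candidates, $n$ voters and committee size $k$, the outcome of Online MES satisfies EJR up to $p$ candidates with probability at least $(1/e)^{k-p}-\varepsilon$. In particular ($p=0$), it satisfies EJR with probability at least $(1/e)^k-\varepsilon$. -/

import Mathlib

/-- An election with candidates `Fin m`, voters `Fin n`, committee size bound `k` with
`2 ≤ k < m`, and nonnegative cardinal ballots `u i c` (utility of voter `i` for candidate `c`). -/
structure Election (m n k : ℕ) where
  u : Fin n → Fin m → ℝ
  u_nonneg : ∀ i c, 0 ≤ u i c
  two_le : 2 ≤ k
  k_lt : k < m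

namespace Election

variable {m n k : ℕ}

/-- Additive utility of voter `i` for a set `W` of candidates. -/
def util (E : Election m n k) (i : Fin n) (W : Finset (Fin m)) : ℝ := ∑ c ∈ W, E.u i c

/-- Single-approval instances: every voter has positive utility for at most one candidate. -/
def SingleApproval (E : Election m n k) : Prop :=
  ∀ i c d, 0 < E.u i c → 0 < E.u i d → c = d

/-- The (nonempty) group `S` of voters is `(α, T)`-cohesive. -/
def Cohesive (E : Election m n k) (α : Fin m → ℝ) (T : Finset (Fin m)) (S : Finset (Fin n)) :
    Prop :=
  S.Nonempty ∧ (T.card : ℝ) / k ≤ (S.card : ℝ) / n ∧ ∀ i ∈ S, ∀ c ∈ T, α c ≤ E.u i c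

/-- The committee `W` provides Extended Justified Representation. -/
def EJR (E : Election m n k) (W : Finset (Fin m)) : Prop :=
  ∀ (α : Fin m → ℝ) (T : Finset (Fin m)) (S : Finset (Fin n)), (∀ c, 0 ≤ α c) →
    E.Cohesive α T S → ∃ i ∈ S, ∑ c ∈ T, α c ≤ E.util i W

/-- The committee `W` provides Extended Justified Representation up to `p` candidates. -/
def EJRUpTo (E : Election m n k) (p : ℕ) (W : Finset (Fin m)) : Prop :=
  ∀ (α : Fin m → ℝ) (T : Finset (Fin m)) (S : Finset (Fin n)), (∀ c, 0 ≤ α c) →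
    E.Cohesive α T S →
      ∃ i ∈ S, ∃ X : Finset (Fin m), X.card ≤ p ∧ ∑ c ∈ T, α c ≤ E.util i (W ∪ X)

/-! ### The Method of Equal Shares -/

/-- With remaining budgets `b`, candidate `c` (of cost `1`) is `ρ`-affordable. -/
def Affordable (E : Election m n k) (b : Fin n → ℝ) (c : Fin m) (ρ : ℝ) : Prop :=
  0 ≤ ρ ∧ ∑ i, min (b i) (ρ * E.u i c) = 1

/-- The smallest `ρ` for which `c` is `ρ`-affordable (used only if there is such a `ρ`). -/
noncomputable def rho (E : Election m n k) (b : Fin n → ℝ) (c : Fin m) : ℝ :=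
  sInf {ρ | E.Affordable b c ρ}

/-- `c` may be bought next, when the available candidates are `X`, those in `W` are already
bought, and the remaining budgets are `b`. -/
def Buyable (E : Election m n k) (X W : Finset (Fin m)) (b : Fin n → ℝ) (c : Fin m) : Prop :=
  c ∈ X ∧ c ∉ W ∧ ∃ ρ, E.Affordable b c ρ

/-- `c` is bought next: it is buyable with the smallest `ρ`; ties are broken by the rank `tie`. -/
def IsNext (E : Election m n k) (tie : Equiv.Perm (Fin m)) (X W : Finset (Fin m))
    (b : Fin n → ℝ) (c : Fin m) : Prop :=
  E.Buyable X W b c ∧ ∀ d, E.Buyable X W b d → d ≠ c →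
    E.rho b c < E.rho b d ∨ (E.rho b c = E.rho b d ∧ tie c < tie d)

open Classical in
/-- One round of the Method of Equal Shares, on pairs (bought candidates, remaining budgets). -/
noncomputable def mesStep (E : Election m n k) (tie : Equiv.Perm (Fin m)) (X : Finset (Fin m))
    (s : Finset (Fin m) × (Fin n → ℝ)) : Finset (Fin m) × (Fin n → ℝ) :=
  if h : ∃ c, E.IsNext tie X s.1 s.2 c then
    (insert h.choose s.1,
      fun i => s.2 i - min (s.2 i) (E.rho s.2 h.choose * E.u i h.choose))
  else s

/-- The Method of Equal Shares (without completion) on the restriction of `E` to the candidates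
in `X`. Every voter starts with budget `k / n`. Each effective round buys a new candidate, so
after `m` rounds nothing more is affordable. -/
noncomputable def mesCore (E : Election m n k) (tie : Equiv.Perm (Fin m)) (X : Finset (Fin m)) :
    Finset (Fin m) :=
  ((E.mesStep tie X)^[m] (∅, fun _ => (k : ℝ) / n)).1

open Classical in
/-- The Method of Equal Shares on the restriction of `E` to `X`, completed to a committee of size
`min k |X|`: while there are fewer than `k` winners, the remaining candidate of largest `score`
is added, ties being broken by the rank `tie`. Taking for the score of `c` its total utility
`∑ i, E.u i c` gives the utilitarian completion. -/
noncomputable def mes (E : Election m n k) (score : Fin m → ℝ) (tie : Equiv.Perm (Fin m))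
    (X : Finset (Fin m)) : Finset (Fin m) :=
  E.mesCore tie X ∪ (X \ E.mesCore tie X).filter fun c =>
    ((X \ E.mesCore tie X).filter fun d =>
      score c < score d ∨ (score d = score c ∧ tie d < tie c)).card
        < k - (E.mesCore tie X).card

/-! ### The Online Method of Equal Shares -/

open Classical in
/-- The selection phase: `CR` is the reference committee, the list is the stream of candidates
that are still to arrive, `R` is the running committee, `W` is the set of hired candidates. -/
noncomputable def onlineLoop (E : Election m n k) (score : Fin m → ℝ) (tie : Equiv.Perm (Fin m))
    (CR : Finset (Fin m)) :
    List (Fin m) → Finset (Fin m) → Finset (Fin m) → Finset (Fin m)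
  | [], _, W => W
  | c :: rest, R, W =>
    -- safeguard: as many candidates remain as there are free seats
    if W.card + (rest.length + 1) = k then W ∪ (c :: rest).toFinset
    else
      let M := E.mes score tie (insert c R)
      -- hire `c` if it pushes out a member of the reference committee
      let W₁ := if ∃ d ∈ R \ M, d ∈ CR then insert c W else W
      -- update the running committee whenever `c` is selected, hired or not
      let R₁ := if c ∈ M then insert c R \ (R \ M) else R
      if W₁.card = k then W₁ else onlineLoop E score tie CR rest R₁ W₁

/-- The committee returned by the Online Method of Equal Shares with threshold `t`, if the
candidate at arrival position `j` is `σ j`. -/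
noncomputable def onlineMES (E : Election m n k) (score : Fin m → ℝ) (tie : Equiv.Perm (Fin m))
    (t : ℕ) (σ : Equiv.Perm (Fin m)) : Finset (Fin m) :=
  let CR := E.mes score tie ((List.ofFn σ).take t).toFinset
  E.onlineLoop score tie CR ((List.ofFn σ).drop t) CR ∅

end Election

open Classical in
/-- Probability of `P` under a uniformly random arrival order of `m` candidates. -/
noncomputable def arrivalProb (m : ℕ) (P : Equiv.Perm (Fin m) → Prop) : ℝ :=
  ((Finset.univ.filter P).card : ℝ) / Fintype.card (Equiv.Perm (Fin m))

/-! Under single approval distinct candidates have disjoint supporters, so a purchase never touches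
the budgets of another candidate's supporters. Hence the Method of Equal Shares buys exactly the
candidates that their supporters can jointly afford (`mesCore_eq`), and its completed outcome on `X`
is the first `k` elements of `X` in one fixed linear order (`mes_eq_firstBy`). The online method
becomes a `k`-secretary algorithm: it hires whoever pushes a sampled reference member out of the
running top `k`.

`RevGood` describes, backwards in time, orders in which each member of the overall top `k` arrives
after the sample and displaces a sampled candidate; then all of them are hired
(`firstBy_univ_subset_onlineMES`). Choosing the last arrival gives a recurrence, solved up to
factorials by `a!` times the elementary symmetric polynomial of degree `a` in the weights `1 / (s +
1 + j)`. `orderBound` is a simpler subsolution, roughly the `a`-th power of the sum of the weights.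
A sample of size about `m / e` makes this sum at least `1`, and the factorials contribute `(1 / e) ^
k` in the limit.

A cohesive group with nonzero demand wants a single well-supported candidate, and these all belong
to the top `k`, so EJR follows. For `p ≥ 1` that candidate may serve as the extra set, so only `p =
0` needs the probabilistic argument. Feasibility rests on the safeguard alone. -/

/-! ### The first `k` elements of a finite set in a linear order -/

section FirstBy

variable {α β : Type*} [LinearOrder β]

/-- The elements of `X` that have fewer than `k` elements of `X` before them in the order given by
the key `r`, that is, the first `k` elements of `X` if `r` is injective. -/
def firstBy (r : α → β) (k : ℕ) (X : Finset α) : Finset α :=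
  X.filter fun c => (X.filter fun d => r d < r c).card < k

theorem mem_firstBy {r : α → β} {k : ℕ} {X : Finset α} {c : α} :
    c ∈ firstBy r k X ↔ c ∈ X ∧ (X.filter fun d => r d < r c).card < k := by
  simp [firstBy]

theorem firstBy_subset (r : α → β) (k : ℕ) (X : Finset α) : firstBy r k X ⊆ X :=
  Finset.filter_subset _ _

theorem mem_firstBy_of_subset {r : α → β} {k : ℕ} {X Y : Finset α} {c : α} (hYX : Y ⊆ X)
    (hc : c ∈ firstBy r k X) (hY : c ∈ Y) : c ∈ firstBy r k Y :=
  mem_firstBy.2 ⟨hY, (Finset.card_le_card (Finset.filter_subset_filter _ hYX)).trans_lt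
    (mem_firstBy.1 hc).2⟩

theorem card_firstBy {r : α → β} (hr : Function.Injective r) (k : ℕ) (X : Finset α) :
    (firstBy r k X).card = min k X.card := by
  classical
  set pos : α → ℕ := fun c => (X.filter fun d => r d < r c).card with hpos
  have hlt : ∀ c ∈ X, ∀ d ∈ X, r c < r d → pos c < pos d := by
    intro c hc d _ hcd
    apply Finset.card_lt_card
    rw [Finset.ssubset_iff_of_subset]
    · exact ⟨c, by simp [hc, hcd], by simp⟩
    · intro x hx
      simp only [Finset.mem_filter] at hx ⊢
      exact ⟨hx.1, hx.2.trans hcd⟩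
  have hinj : Set.InjOn pos X := by
    intro c hc d hd h
    rcases lt_trichotomy (r c) (r d) with h' | h' | h'
    · exact absurd h (hlt c hc d hd h').ne
    · exact hr h'
    · exact absurd h (hlt d hd c hc h').ne'
  have himg : X.image pos = Finset.range X.card := by
    apply Finset.eq_of_subset_of_card_le
    · intro y hy
      obtain ⟨c, hc, rfl⟩ := Finset.mem_image.1 hy
      rw [Finset.mem_range]
      apply Finset.card_lt_card
      rw [Finset.ssubset_iff_of_subset (Finset.filter_subset _ _)]
      exact ⟨c, hc, by simp⟩
    · rw [Finset.card_image_of_injOn hinj, Finset.card_range]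
  have h1 : (firstBy r k X).image pos = (Finset.range X.card).filter (· < k) := by
    rw [← himg, Finset.filter_image]
    rfl
  have h2 : (Finset.range X.card).filter (· < k) = Finset.range (min k X.card) := by
    ext x
    simp only [Finset.mem_filter, Finset.mem_range, lt_min_iff]
    exact and_comm
  rw [← Finset.card_range (min k X.card), ← h2, ← h1, Finset.card_image_of_injOn]
  exact hinj.mono (by exact_mod_cast firstBy_subset r k X)

variable [DecidableEq α]

/-- Whoever has left the top `k` never returns as the set grows, so the running committee carries
all the information needed later. -/
theorem firstBy_insert_firstBy {r : α → β} (hr : Function.Injective r) (k : ℕ) (X : Finset α)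
    (c : α) : firstBy r k (insert c (firstBy r k X)) = firstBy r k (insert c X) := by
  symm
  apply Finset.eq_of_subset_of_card_le
  · intro x hx
    refine mem_firstBy_of_subset (Finset.insert_subset_insert _ (firstBy_subset r k X)) hx ?_
    rcases Finset.mem_insert.1 (firstBy_subset _ _ _ hx) with rfl | h
    · exact Finset.mem_insert_self _ _
    · exact Finset.mem_insert_of_mem (mem_firstBy_of_subset (Finset.subset_insert _ _) hx h)
  · rw [card_firstBy hr, card_firstBy hr]
    exact min_le_min le_rfl
      (Finset.card_le_card (Finset.insert_subset_insert _ (firstBy_subset r k X)))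

theorem firstBy_insert_of_notMem {r : α → β} (hr : Function.Injective r) {k : ℕ} {X : Finset α}
    {c : α} (hc : c ∉ firstBy r k (insert c X)) : firstBy r k (insert c X) = firstBy r k X := by
  apply Finset.eq_of_subset_of_card_le
  · intro x hx
    refine mem_firstBy_of_subset (Finset.subset_insert _ _) hx ?_
    rcases Finset.mem_insert.1 (firstBy_subset _ _ _ hx) with rfl | h
    · exact absurd hx hc
    · exact h
  · rw [card_firstBy hr, card_firstBy hr]
    exact min_le_min le_rfl (Finset.card_le_card (Finset.subset_insert _ _))

theorem exists_mem_firstBy_notMem_insert {r : α → β} (hr : Function.Injective r) {k : ℕ}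
    {X : Finset α} {c : α} (hk : k ≤ X.card) (hX : c ∉ X) (hc : c ∈ firstBy r k (insert c X)) :
    ∃ d ∈ firstBy r k X, d ∉ firstBy r k (insert c X) := by
  by_contra! h
  have h1 : insert c (firstBy r k X) ⊆ firstBy r k (insert c X) :=
    Finset.insert_subset hc h
  have h2 := Finset.card_le_card h1
  rw [Finset.card_insert_of_notMem fun h => hX (firstBy_subset _ _ _ h), card_firstBy hr,
    card_firstBy hr, Finset.card_insert_of_notMem hX] at h2
  omega

/-! ### Counting favourable arrival orders -/

/-- The list `p ++ q` is an arrival order read backwards, `q` being the sample. Read backwards, the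
order `p` removes all elements of `A`, and any other element it removes is, at that moment, not
among the first `k` elements that are left. -/
def RevGood (r : α → β) (k : ℕ) (q : List α) : Finset α → List α → Prop
  | A, [] => A = ∅
  | A, x :: p => (x ∈ A ∨ x ∉ firstBy r k (x :: (p ++ q)).toFinset) ∧ RevGood r k q (A.erase x) p

/-- Deleting other elements keeps `y` among the first `k`, so `p` is never allowed to remove it. -/
theorem RevGood.mem_sample {r : α → β} {k : ℕ} {q : List α} {y : α} : ∀ {p : List α} {A : Finset α},
    RevGood r k q A p → y ∈ firstBy r k (p ++ q).toFinset → y ∉ A → y ∈ q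
  | [], A, _, hy, _ => by simpa using firstBy_subset _ _ _ hy
  | x :: p, A, h, hy, hA => by
    have hxy : y ≠ x := by
      rintro rfl
      exact h.1.elim hA fun h' => h' hy
    refine RevGood.mem_sample h.2 (mem_firstBy_of_subset ?_ hy ?_) fun h' =>
      hA (Finset.mem_of_mem_erase h')
    · simp
    · have := firstBy_subset _ _ _ hy
      simpa [hxy] using this

/-- Split the order at the arrival of `x`: whatever `x` displaces comes from the sample, which is
what triggers hiring. -/
theorem RevGood.exists_append {r : α → β} {k : ℕ} {q : List α} {x : α} :
    ∀ {p : List α} {A : Finset α}, RevGood r k q A p → A ⊆ firstBy r k (p ++ q).toFinset → x ∈ A →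
      ∃ p₁ p₂, p = p₁ ++ x :: p₂ ∧ ∀ y ∈ firstBy r k (p₂ ++ q).toFinset,
        y ∉ firstBy r k (insert x (p₂ ++ q).toFinset) → y ∈ q
  | [], A, h, _, hx => by
    rw [show A = ∅ from h] at hx
    simp at hx
  | z :: p, A, h, hA, hx => by
    by_cases hxz : x = z
    · subst hxz
      -- The targets still in `A` stay in the top `k` when `x` arrives, so the displaced `y` is not
      -- a target.
      refine ⟨[], p, rfl, fun y hy hy' => h.2.mem_sample hy fun h' => hy' ?_⟩
      have := hA (Finset.mem_of_mem_erase h')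
      simpa using this
    · obtain ⟨p₁, p₂, rfl, h'⟩ := RevGood.exists_append (x := x) h.2 (fun a ha => by
        rw [Finset.mem_erase] at ha
        refine mem_firstBy_of_subset ?_ (hA ha.2) ?_
        · simp
        · simpa [ha.1] using firstBy_subset _ _ _ (hA ha.2)) (Finset.mem_erase.2 ⟨hxz, hx⟩)
      exact ⟨z :: p₁, p₂, rfl, h'⟩

/-- A lower bound for the number of favourable arrival orders of `s + k + d` elements with `a`
elements to be hired and a sample of size `s + k`. -/
noncomputable def orderBound (s k d a : ℕ) : ℝ :=
  (s + k).factorial * (s + 1).ascFactorial d *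
    max 0 (∑ j ∈ Finset.range d, 1 / ((s : ℝ) + 1 + j) - a / ((s : ℝ) + 1)) ^ a

/-! ### A recurrence for the number of favourable orders -/

/-- The mean value bound for `x ^ a`, proved by induction. -/
theorem pow_le_pow_add_mul {x y w : ℝ} (hy : 0 ≤ y) (hyx : y ≤ x) (hw : x ≤ y + w) (a : ℕ) :
    x ^ a ≤ y ^ a + a * w * x ^ (a - 1) := by
  have hx : 0 ≤ x := hy.trans hyx
  induction a with
  | zero => simp
  | succ a ih =>
    have hw0 : 0 ≤ w := by linarith
    have h1 : (a : ℝ) * x ^ (a - 1) * x = a * x ^ a := by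
      cases a with
      | zero => simp
      | succ a => simp only [Nat.add_sub_cancel, pow_succ]; ring
    have h2 : y ^ a ≤ x ^ a := pow_le_pow_left₀ hy hyx a
    have h3 : x ^ a * x ≤ (y ^ a + a * w * x ^ (a - 1)) * x := mul_le_mul_of_nonneg_right ih hx
    have h4 : y ^ a * x ≤ y ^ a * y + w * x ^ a := by
      have h5 : y ^ a * x ≤ y ^ a * (y + w) := mul_le_mul_of_nonneg_left hw (pow_nonneg hy a)
      nlinarith [mul_le_mul_of_nonneg_left h2 hw0]
    simp only [Nat.add_sub_cancel, pow_succ]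
    push_cast
    nlinarith

/-- The two terms correspond to the last arrival being one of the `a` targets, or one of the `s + 1
+ d` elements outside the top `k`. -/
theorem orderBound_succ_le (s k d a : ℕ) :
    orderBound s k (d + 1) a ≤
      a * orderBound s k d (a - 1) + (s + 1 + d) * orderBound s k d a := by
  rcases Nat.eq_zero_or_pos a with rfl | ha
  · simp only [orderBound, Nat.ascFactorial_succ]
    push_cast
    simp only [pow_zero, zero_mul, mul_one, zero_add]
    exact le_of_eq (by ring)
  obtain ⟨b, rfl⟩ : ∃ b, a = b + 1 := ⟨a - 1, by omega⟩
  simp only [orderBound, Nat.ascFactorial_succ, Nat.add_sub_cancel, Finset.sum_range_succ]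
  set L := ∑ j ∈ Finset.range d, 1 / ((s : ℝ) + 1 + j)
  have hpos : (0 : ℝ) < (s : ℝ) + 1 := by positivity
  set v := (s : ℝ) + 1 with hv
  have hvd : 0 < v + d := by positivity
  have hw : 1 / (v + d) ≤ 1 / v := one_div_le_one_div_of_le hpos (by simp)
  have hw0 : 0 < 1 / (v + d) := by positivity
  set y := max 0 (L - ((b + 1 : ℕ) : ℝ) / v)
  set x := max 0 (L + 1 / (v + d) - ((b + 1 : ℕ) : ℝ) / v)
  set z := max 0 (L - (b : ℝ) / v)
  have hy : 0 ≤ y := le_max_left _ _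
  have hyx : y ≤ x := max_le_max le_rfl (by linarith)
  have hxy : x ≤ y + 1 / (v + d) := by
    apply max_le
    · positivity
    · have := le_max_right 0 (L - ((b + 1 : ℕ) : ℝ) / v)
      linarith
  -- This is the purpose of the correction `a / (s + 1)`: lowering `a` by one frees `1 / (s + 1)`,
  -- which covers the new weight `1 / (s + 1 + d)`.
  have hxz : x ≤ z := by
    apply max_le_max le_rfl
    push_cast
    rw [add_div]
    linarith
  have h1 := pow_le_pow_add_mul hy hyx hxy (b + 1)
  have h2 : x ^ b ≤ z ^ b := pow_le_pow_left₀ (hy.trans hyx) hxz b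
  simp only [Nat.add_sub_cancel] at h1
  have h3 : (v + d) * x ^ (b + 1) ≤ (v + d) * y ^ (b + 1) + ((b + 1 : ℕ) : ℝ) * z ^ b := by
    calc (v + d) * x ^ (b + 1)
        ≤ (v + d) * (y ^ (b + 1) + ((b + 1 : ℕ) : ℝ) * (1 / (v + d)) * z ^ b) := by
          gcongr
          exact h1.trans (by gcongr)
      _ = _ := by field_simp
  have h4 : (0 : ℝ) ≤ (s + k).factorial * (s + 1).ascFactorial d := by positivity
  have h5 := mul_le_mul_of_nonneg_left h3 h4
  push_cast at h5 ⊢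
  rw [← hv]
  linarith

/-- Induction on `d`, branching on the last arrival; branches are disjoint because their lists have
different heads. -/
theorem exists_revGood_lists {r : α → β} (hr : Function.Injective r) (s k : ℕ) (d : ℕ) :
    ∀ (S A : Finset α), S.card = s + k + d → A ⊆ firstBy r k S →
      ∃ L : Finset (List α),
        (∀ l ∈ L, l.Nodup ∧ l.toFinset = S ∧
          ∃ p q, l = p ++ q ∧ q.length = s + k ∧ RevGood r k q A p) ∧
        orderBound s k d A.card ≤ L.card := by
  induction d with
  | zero =>
    intro S A hS hA
    rcases A.eq_empty_or_nonempty with rfl | hne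
    · refine ⟨S.toList.permutations.toFinset, fun l hl => ?_, ?_⟩
      · have hp : l.Perm S.toList := by simpa using hl
        refine ⟨hp.nodup_iff.2 S.nodup_toList, ?_, [], l, rfl, ?_, rfl⟩
        · rw [List.toFinset_eq_of_perm _ _ hp, Finset.toList_toFinset]
        · rw [hp.length_eq, Finset.length_toList, hS, add_zero]
      · rw [List.toFinset_card_of_nodup (List.nodup_permutations _ S.nodup_toList),
          List.length_permutations, Finset.length_toList, hS]
        simp [orderBound]
    -- With no arrivals after the sample the sum is empty, the maximum is `0`, and its positive
    -- power vanishes.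
    · refine ⟨∅, by simp, ?_⟩
      have h1 : A.card ≠ 0 := hne.card_pos.ne'
      have h2 : (0 : ℝ) ≤ (A.card : ℝ) / ((s : ℝ) + 1) := by positivity
      simp [orderBound, max_eq_left (neg_nonpos.2 h2), h1]
  | succ d ih =>
    intro S A hS hA
    have hfirst : (firstBy r k S).card = k := by
      rw [card_firstBy hr, hS]
      omega
    have hrest : (S \ firstBy r k S).card = s + 1 + d := by
      rw [Finset.card_sdiff_of_subset (firstBy_subset _ _ _), hfirst, hS]
      omega
    -- `B` consists of the last arrivals that `RevGood` permits.
    set B := A ∪ S \ firstBy r k S with hB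
    have hdisj : Disjoint A (S \ firstBy r k S) :=
      Finset.disjoint_of_subset_left hA Finset.disjoint_sdiff
    have hBS : B ⊆ S :=
      Finset.union_subset (hA.trans (firstBy_subset _ _ _)) Finset.sdiff_subset
    have hex : ∀ x ∈ B, ∃ L : Finset (List α),
        (∀ l ∈ L, l.Nodup ∧ l.toFinset = S.erase x ∧
          ∃ p q, l = p ++ q ∧ q.length = s + k ∧ RevGood r k q (A.erase x) p) ∧
        orderBound s k d (A.erase x).card ≤ L.card := by
      intro x hx
      apply ih
      · rw [Finset.card_erase_of_mem (hBS hx), hS]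
        omega
      · intro a ha
        rw [Finset.mem_erase] at ha
        exact mem_firstBy_of_subset (Finset.erase_subset _ _) (hA ha.2)
          (Finset.mem_erase.2 ⟨ha.1, firstBy_subset _ _ _ (hA ha.2)⟩)
    choose! f hf hcard using hex
    refine ⟨B.biUnion fun x => (f x).map ⟨List.cons x, List.cons_injective⟩, fun l hl => ?_, ?_⟩
    · simp only [Finset.mem_biUnion, Finset.mem_map, Function.Embedding.coeFn_mk] at hl
      obtain ⟨x, hx, l, hl, rfl⟩ := hl
      obtain ⟨hnd, hset, p, q, rfl, hq, hgood⟩ := hf x hx l hl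
      have hset' : (x :: (p ++ q)).toFinset = S := by
        rw [List.toFinset_cons, hset, Finset.insert_erase (hBS hx)]
      refine ⟨List.nodup_cons.2 ⟨fun h => ?_, hnd⟩, hset', x :: p, q, rfl, hq, ?_, hgood⟩
      · rw [← List.mem_toFinset, hset] at h
        simp at h
      · rw [hset']
        rcases Finset.mem_union.1 hx with h | h
        · exact Or.inl h
        · exact Or.inr (Finset.mem_sdiff.1 h).2
    · rw [Finset.card_biUnion]
      · refine (orderBound_succ_le s k d A.card).trans ?_
        rw [hB, Finset.sum_union hdisj]
        push_cast
        refine add_le_add ?_ ?_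
        · rw [← nsmul_eq_mul]
          refine Finset.card_nsmul_le_sum _ _ _ fun x hx => ?_
          rw [Finset.card_map, ← Finset.card_erase_of_mem hx]
          exact hcard x (Finset.mem_union_left _ hx)
        · have h1 : ((s : ℝ) + 1 + d) = ((S \ firstBy r k S).card : ℝ) := by
            rw [hrest]
            push_cast
            ring
          rw [h1, ← nsmul_eq_mul]
          refine Finset.card_nsmul_le_sum _ _ _ fun x hx => ?_
          have h2 : x ∉ A := fun h => Finset.disjoint_left.1 hdisj h hx
          have h3 := hcard x (Finset.mem_union_right _ hx)
          rw [Finset.erase_eq_of_notMem h2] at h3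
          rw [Finset.card_map]
          exact h3
      · intro x _ y _ hxy
        rw [Function.onFun, Finset.disjoint_left]
        intro l hl hl'
        simp only [Finset.mem_map, Function.Embedding.coeFn_mk] at hl hl'
        obtain ⟨l₁, _, rfl⟩ := hl
        obtain ⟨l₂, _, h⟩ := hl'
        exact hxy (List.cons.inj h).1.symm

end FirstBy

/-! ### Estimates -/

theorem log_le_sum_one_div (s d : ℕ) :
    Real.log ((s : ℝ) + 1 + d) - Real.log ((s : ℝ) + 1) ≤
      ∑ j ∈ Finset.range d, 1 / ((s : ℝ) + 1 + j) := by
  induction d with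
  | zero => simp
  | succ d ih =>
    rw [Finset.sum_range_succ]
    have hx : (0 : ℝ) < (s : ℝ) + 1 + d := by positivity
    have h1 := Real.log_le_sub_one_of_pos (x := ((s : ℝ) + 1 + d + 1) / ((s : ℝ) + 1 + d))
      (by positivity)
    rw [Real.log_div (by positivity) hx.ne', add_div, div_self hx.ne'] at h1
    push_cast
    rw [← add_assoc]
    linarith

/-- Here `s + k` is the sample size and `s + k + d` the number of candidates; the bound splits into
a factorial quotient and the power from `orderBound`. -/
theorem le_orderBound_div {s k d : ℕ} (hk : 1 ≤ k) (hs : k ≤ s + 1)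
    (he : ((s : ℝ) + k) * Real.exp 1 ≤ (s + k + d : ℕ)) :
    ((((s : ℝ) + 1 - k) / (s + k + d : ℕ))) ^ k ≤
      orderBound s k d k / (s + k + d).factorial := by
  have hv : (0 : ℝ) < (s : ℝ) + 1 := by positivity
  have hk' : (1 : ℝ) ≤ k := by exact_mod_cast hk
  have hs' : (k : ℝ) ≤ s + 1 := by exact_mod_cast hs
  have hm : (0 : ℝ) < (s + k + d : ℕ) := by exact_mod_cast (by omega : 0 < s + k + d)
  have hexp : 1 ≤ Real.exp 1 := Real.one_le_exp zero_le_one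
  -- Since `k ≥ 1`, the ratio `(s + 1 + d) / (s + 1)` is at least `(s + k + d) / (s + k)`, hence at
  -- least `e`.
  have hsum : 1 ≤ ∑ j ∈ Finset.range d, 1 / ((s : ℝ) + 1 + j) := by
    refine le_trans ?_ (log_le_sum_one_div s d)
    rw [← Real.log_div (by positivity) hv.ne', Real.le_log_iff_exp_le (by positivity),
      le_div_iff₀ hv]
    push_cast at he
    nlinarith
  have hmax : ((s : ℝ) + 1 - k) / (s + 1) ≤
      max 0 (∑ j ∈ Finset.range d, 1 / ((s : ℝ) + 1 + j) - k / ((s : ℝ) + 1)) := by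
    refine le_trans ?_ (le_max_right _ _)
    rw [sub_div, div_self hv.ne']
    linarith
  -- The quotient equals `((s + k)! / s!) / ((s + k + d)! / (s + d)!)`, two products of `k` factors:
  -- those above are at least `s + 1`, those below at most `s + k + d`.
  have hfac : (((s : ℝ) + 1) / (s + k + d : ℕ)) ^ k ≤
      ((s + k).factorial * (s + 1).ascFactorial d : ℝ) / (s + k + d).factorial := by
    rw [div_pow, div_le_div_iff₀ (by positivity) (by positivity)]
    have h1 : (s + 1) ^ k ≤ (s + k).descFactorial k := by
      have := Nat.pow_sub_le_descFactorial (s + k) k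
      rwa [show s + k + 1 - k = s + 1 by omega] at this
    have h2 : s.factorial * (s + k).descFactorial k = (s + k).factorial := by
      have := Nat.factorial_mul_descFactorial (show k ≤ s + k by omega)
      rwa [Nat.add_sub_cancel] at this
    have h3 : s.factorial * (s + 1).ascFactorial d = (s + d).factorial :=
      Nat.factorial_mul_ascFactorial s d
    have h4 : (s + d).factorial * (s + k + d).descFactorial k = (s + k + d).factorial := by
      have := Nat.factorial_mul_descFactorial (show k ≤ s + k + d by omega)
      rwa [show s + k + d - k = s + d by omega] at this
    have h5 : (s + k + d).descFactorial k ≤ (s + k + d) ^ k := Nat.descFactorial_le_pow _ _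
    have h6 : (s + 1) ^ k * (s + k + d).factorial ≤
        (s + k).factorial * (s + 1).ascFactorial d * (s + k + d) ^ k := by
      calc (s + 1) ^ k * (s + k + d).factorial
          ≤ (s + k).descFactorial k * ((s + d).factorial * (s + k + d) ^ k) := by
            rw [← h4]
            gcongr
        _ = _ := by rw [← h3, ← h2]; ring
    exact_mod_cast h6
  have h0 : (0 : ℝ) ≤ ((s : ℝ) + 1 - k) / (s + 1) := div_nonneg (by linarith) hv.le
  calc ((((s : ℝ) + 1 - k) / (s + k + d : ℕ))) ^ k
      = (((s : ℝ) + 1) / (s + k + d : ℕ)) ^ k * (((s : ℝ) + 1 - k) / (s + 1)) ^ k := by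
        rw [← mul_pow]
        congr 1
        field_simp
    _ ≤ ((s + k).factorial * (s + 1).ascFactorial d : ℝ) / (s + k + d).factorial *
        max 0 (∑ j ∈ Finset.range d, 1 / ((s : ℝ) + 1 + j) - k / ((s : ℝ) + 1)) ^ k := by
        gcongr
    _ = _ := by
        rw [orderBound]
        ring


namespace Election

variable {m n k : ℕ}

/-! ### The Method of Equal Shares on single-approval instances -/

open Classical in
/-- The voters with positive utility for `c` can jointly pay for `c` from their initial budgets. -/
def WellSupported (E : Election m n k) (c : Fin m) : Prop :=
  1 ≤ ((Finset.univ.filter fun i => 0 < E.u i c).card : ℝ) * ((k : ℝ) / n)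

-- Supporter sets are disjoint, and each commands at least `1` out of the total budget `k`. For `n =
-- 0` the budget `k / n` is `0`, so no candidate qualifies.
open Classical in
theorem card_wellSupported_le (E : Election m n k) (hE : E.SingleApproval) :
    (Finset.univ.filter E.WellSupported).card ≤ k := by
  rcases Nat.eq_zero_or_pos n with rfl | hn
  · have : Finset.univ.filter E.WellSupported = ∅ := by
      apply Finset.filter_eq_empty_iff.2
      intro c _ h
      simp only [WellSupported, Nat.cast_zero, div_zero, mul_zero] at h
      linarith
    simp [this]
  set H := Finset.univ.filter E.WellSupported
  set V : Fin m → Finset (Fin n) := fun c => Finset.univ.filter fun i => 0 < E.u i c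
  have h1 : ∑ c ∈ H, (V c).card ≤ n := by
    rw [← Finset.card_biUnion]
    · exact (Finset.card_le_univ _).trans_eq (Fintype.card_fin n)
    · intro c _ d _ hcd
      rw [Function.onFun, Finset.disjoint_left]
      intro i hi hi'
      exact hcd (hE i c d (Finset.mem_filter.1 hi).2 (Finset.mem_filter.1 hi').2)
  have h2 : (H.card : ℝ) ≤ ∑ c ∈ H, ((V c).card : ℝ) * ((k : ℝ) / n) := by
    have := Finset.card_nsmul_le_sum H (fun c => ((V c).card : ℝ) * ((k : ℝ) / n)) 1
      fun c hc => (Finset.mem_filter.1 hc).2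
    simpa using this
  rw [← Finset.sum_mul] at h2
  have h3 : (∑ c ∈ H, ((V c).card : ℝ)) ≤ n := by exact_mod_cast h1
  have h4 : (H.card : ℝ) ≤ k := by
    calc (H.card : ℝ) ≤ _ := h2
      _ ≤ n * ((k : ℝ) / n) := by gcongr
      _ = k := by field_simp
  exact_mod_cast h4

/-- The states reachable by the Method of Equal Shares on `X`: only well-supported candidates have
been bought, and voters without utility for a bought candidate have kept their budget. -/
structure Reachable (E : Election m n k) (X : Finset (Fin m))
    (s : Finset (Fin m) × (Fin n → ℝ)) : Prop where
  mem : ∀ c ∈ s.1, c ∈ X ∧ E.WellSupported c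
  nonneg : ∀ i, 0 ≤ s.2 i
  le : ∀ i, s.2 i ≤ (k : ℝ) / n
  eq : ∀ i, (∀ c ∈ s.1, E.u i c = 0) → s.2 i = (k : ℝ) / n

theorem rho_nonneg (E : Election m n k) (b : Fin n → ℝ) (c : Fin m) : 0 ≤ E.rho b c :=
  Real.sInf_nonneg fun _ h => h.1

theorem Buyable.wellSupported {E : Election m n k} {X : Finset (Fin m)}
    {s : Finset (Fin m) × (Fin n → ℝ)} (hs : E.Reachable X s) {c : Fin m}
    (hc : E.Buyable X s.1 s.2 c) : E.WellSupported c := by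
  classical
  obtain ⟨-, -, ρ, -, h⟩ := hc
  rw [WellSupported, ← h, ← nsmul_eq_mul, ← Finset.sum_const, Finset.sum_filter]
  refine Finset.sum_le_sum fun i _ => ?_
  split_ifs with hi
  · exact (min_le_left _ _).trans (hs.le i)
  · have : E.u i c = 0 := le_antisymm (not_lt.1 hi) (E.u_nonneg i c)
    simp [this]

/-- No supporter of `c` has paid for anything else, so all hold their full budget; the intermediate
value theorem then gives a suitable `ρ`. -/
theorem WellSupported.buyable {E : Election m n k} (hE : E.SingleApproval) {X : Finset (Fin m)}
    {s : Finset (Fin m) × (Fin n → ℝ)} (hs : E.Reachable X s) {c : Fin m} (hX : c ∈ X)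
    (hW : c ∉ s.1) (hc : E.WellSupported c) : E.Buyable X s.1 s.2 c := by
  classical
  refine ⟨hX, hW, ?_⟩
  set V := Finset.univ.filter fun i => 0 < E.u i c with hV
  have hkn : (0 : ℝ) ≤ (k : ℝ) / n := by positivity
  -- Large enough that every supporter exhausts the budget; a sum replaces the maximum to avoid a
  -- nonemptiness argument.
  set ρ := ∑ i ∈ V, (k : ℝ) / n / E.u i c with hρ
  have hterm : ∀ i ∈ V, 0 ≤ (k : ℝ) / n / E.u i c := fun i _ => div_nonneg hkn (E.u_nonneg i c)
  have hρ0 : 0 ≤ ρ := Finset.sum_nonneg hterm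
  have hcont : ContinuousOn (fun x : ℝ => ∑ i, min (s.2 i) (x * E.u i c)) (Set.Icc 0 ρ) := by
    fun_prop
  have hlow : ∑ i, min (s.2 i) (0 * E.u i c) ≤ 1 := by
    simp [hs.nonneg]
  have hhigh : 1 ≤ ∑ i, min (s.2 i) (ρ * E.u i c) := by
    rw [WellSupported, ← nsmul_eq_mul, ← Finset.sum_const, Finset.sum_filter] at hc
    refine hc.trans (Finset.sum_le_sum fun i _ => ?_)
    split_ifs with hi
    · have hbud : s.2 i = (k : ℝ) / n := by
        refine hs.eq i fun d hd => le_antisymm (not_lt.1 fun h => hW ?_) (E.u_nonneg i d)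
        rwa [hE i c d hi h]
      rw [hbud]
      refine le_min le_rfl ?_
      rw [← div_le_iff₀ hi]
      exact Finset.single_le_sum hterm (by simp [hV, hi])
    · have : E.u i c = 0 := le_antisymm (not_lt.1 hi) (E.u_nonneg i c)
      simp [this, hs.nonneg]
  obtain ⟨x, hx, hx'⟩ := intermediate_value_Icc hρ0 hcont ⟨hlow, hhigh⟩
  exact ⟨x, hx.1, hx'⟩

theorem exists_isNext (E : Election m n k) (tie : Equiv.Perm (Fin m)) {X W : Finset (Fin m)}
    {b : Fin n → ℝ} {c : Fin m} (hc : E.Buyable X W b c) : ∃ d, E.IsNext tie X W b d := by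
  classical
  obtain ⟨d, hd, hmin⟩ := Finset.exists_min_image (Finset.univ.filter (E.Buyable X W b))
    (fun d => toLex (E.rho b d, tie d)) ⟨c, by simp [hc]⟩
  refine ⟨d, (Finset.mem_filter.1 hd).2, fun x hx hxd => ?_⟩
  have h1 := hmin x (by simp [hx])
  rw [Prod.Lex.toLex_le_toLex] at h1
  rcases h1 with h1 | ⟨h1, h2⟩
  · exact Or.inl h1
  · exact Or.inr ⟨h1, lt_of_le_of_ne h2 fun h => hxd (tie.injective h).symm⟩

theorem Reachable.mesStep {E : Election m n k} (tie : Equiv.Perm (Fin m)) {X : Finset (Fin m)}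
    {s : Finset (Fin m) × (Fin n → ℝ)} (hs : E.Reachable X s) :
    E.Reachable X (E.mesStep tie X s) := by
  classical
  unfold Election.mesStep
  split_ifs with h
  · have hb := h.choose_spec.1
    set c := h.choose
    have hpay : ∀ i, 0 ≤ min (s.2 i) (E.rho s.2 c * E.u i c) := fun i =>
      le_min (hs.nonneg i) (mul_nonneg (E.rho_nonneg _ _) (E.u_nonneg i c))
    refine ⟨?_, fun i => ?_, fun i => ?_, fun i hi => ?_⟩
    · simp only [Finset.mem_insert, forall_eq_or_imp]
      exact ⟨⟨hb.1, hb.wellSupported hs⟩, hs.mem⟩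
    · exact sub_nonneg.2 (min_le_left _ _)
    · exact (sub_le_self _ (hpay i)).trans (hs.le i)
    · simp only [Finset.mem_insert, forall_eq_or_imp] at hi
      have hkn : (0 : ℝ) ≤ (k : ℝ) / n := by positivity
      simp [hi.1, hs.eq i hi.2, hkn]
  · exact hs

open Classical in
theorem mesCore_eq {E : Election m n k} (hE : E.SingleApproval) (tie : Equiv.Perm (Fin m))
    (X : Finset (Fin m)) : E.mesCore tie X = X.filter E.WellSupported := by
  set s₀ : Finset (Fin m) × (Fin n → ℝ) := (∅, fun _ => (k : ℝ) / n)
  have hreach : ∀ j, E.Reachable X ((E.mesStep tie X)^[j] s₀) := by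
    intro j
    induction j with
    | zero => exact ⟨by simp [s₀], fun i => by simp only [Function.iterate_zero, id, s₀]; positivity,
        fun i => le_rfl, fun i _ => rfl⟩
    | succ j ih =>
      rw [Function.iterate_succ_apply']
      exact ih.mesStep tie
  -- Each round buys a new candidate unless all well-supported ones are bought, so `m` rounds
  -- suffice.
  have hprog : ∀ j, j ≤ ((E.mesStep tie X)^[j] s₀).1.card ∨
      X.filter E.WellSupported ⊆ ((E.mesStep tie X)^[j] s₀).1 := by
    intro j
    induction j with
    | zero => exact Or.inl (Nat.zero_le _)
    | succ j ih =>
      rw [Function.iterate_succ_apply']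
      set s := (E.mesStep tie X)^[j] s₀
      by_cases h : ∃ c, E.IsNext tie X s.1 s.2 c
      · have h1 : (E.mesStep tie X s).1 = insert h.choose s.1 := by
          rw [Election.mesStep, dif_pos h]
        rw [h1]
        refine ih.imp (fun ih => ?_) fun ih => ih.trans (Finset.subset_insert _ _)
        rw [Finset.card_insert_of_notMem h.choose_spec.1.2.1]
        omega
      · right
        have h1 : E.mesStep tie X s = s := by
          rw [Election.mesStep, dif_neg h]
        rw [h1]
        intro c hc
        by_contra hcs
        rw [Finset.mem_filter] at hc
        exact h (E.exists_isNext tie (hc.2.buyable hE (hreach j) hc.1 hcs))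
  apply subset_antisymm
  · intro c hc
    exact Finset.mem_filter.2 ((hreach m).mem c hc)
  · rcases hprog m with h | h
    · have h1 : ((E.mesStep tie X)^[m] s₀).1 = Finset.univ := by
        apply Finset.eq_univ_of_card
        rw [Fintype.card_fin]
        exact le_antisymm ((Finset.card_le_univ _).trans_eq (Fintype.card_fin m)) h
      rw [mesCore, h1]
      exact Finset.subset_univ _
    · exact h

open Classical in
/-- On single-approval instances the Method of Equal Shares selects the first candidates with
respect to this key. -/
noncomputable def mesKey (E : Election m n k) (score : Fin m → ℝ) (tie : Equiv.Perm (Fin m))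
    (c : Fin m) : ℕ ×ₗ ℝ ×ₗ Fin m :=
  toLex (if E.WellSupported c then 0 else 1, toLex (-score c, tie c))

theorem mesKey_injective (E : Election m n k) (score : Fin m → ℝ) (tie : Equiv.Perm (Fin m)) :
    Function.Injective (E.mesKey score tie) := by
  intro c d h
  simp only [mesKey, toLex_inj, Prod.mk.injEq] at h
  exact tie.injective h.2.2

theorem mesKey_lt_iff {E : Election m n k} {score : Fin m → ℝ} {tie : Equiv.Perm (Fin m)}
    {c d : Fin m} : E.mesKey score tie d < E.mesKey score tie c ↔
      (E.WellSupported d ∧ ¬ E.WellSupported c) ∨ ((E.WellSupported d ↔ E.WellSupported c) ∧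
        (score c < score d ∨ (score d = score c ∧ tie d < tie c))) := by
  simp only [mesKey, Prod.Lex.toLex_lt_toLex]
  by_cases hc : E.WellSupported c <;> by_cases hd : E.WellSupported d <;> simp [hc, hd]

/-- A well-supported candidate is preceded only by such candidates, at most `k` in all; any other is
preceded by all of these and by those ahead of it in the completion. -/
theorem mes_eq_firstBy {E : Election m n k} (hE : E.SingleApproval) (score : Fin m → ℝ)
    (tie : Equiv.Perm (Fin m)) (X : Finset (Fin m)) :
    E.mes score tie X = firstBy (E.mesKey score tie) k X := by
  classical
  have hcard : (X.filter E.WellSupported).card ≤ k :=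
    (Finset.card_le_card (Finset.filter_subset_filter _ (Finset.subset_univ X))).trans
      (E.card_wellSupported_le hE)
  have hdiff : X \ X.filter E.WellSupported = X.filter fun c => ¬ E.WellSupported c := by
    ext c
    simp only [Finset.mem_sdiff, Finset.mem_filter]
    tauto
  ext c
  rw [mes, mesCore_eq hE, hdiff, Finset.mem_union, Finset.mem_filter, Finset.mem_filter,
    Finset.mem_filter, mem_firstBy]
  by_cases hX : c ∈ X
  · by_cases hc : E.WellSupported c
    · have h1 : (X.filter fun d => E.mesKey score tie d < E.mesKey score tie c).card <
          (X.filter E.WellSupported).card := by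
        apply Finset.card_lt_card
        rw [Finset.ssubset_iff_of_subset]
        · exact ⟨c, by simp [hX, hc], by simp⟩
        · intro d hd
          simp only [Finset.mem_filter, mesKey_lt_iff, hc] at hd ⊢
          tauto
      simp [hX, hc, h1.trans_le hcard]
    · have h1 : (X.filter fun d => E.mesKey score tie d < E.mesKey score tie c) =
          X.filter E.WellSupported ∪ (X.filter fun d => ¬ E.WellSupported d).filter fun d =>
            score c < score d ∨ (score d = score c ∧ tie d < tie c) := by
        ext d
        simp only [Finset.mem_union, Finset.mem_filter, mesKey_lt_iff, hc]
        tauto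
      rw [h1, Finset.card_union_of_disjoint]
      · simp only [hX, hc, not_false_eq_true, and_true, true_and, and_false, false_or]
        omega
      · rw [Finset.disjoint_left]
        intro d hd hd'
        simp only [Finset.mem_filter] at hd hd'
        exact hd'.1.2 hd.2
  · simp [hX]

/-! ### Feasibility of the online method -/

theorem card_onlineLoop (E : Election m n k) (score : Fin m → ℝ) (tie : Equiv.Perm (Fin m))
    (CR : Finset (Fin m)) : ∀ (l : List (Fin m)) (R W : Finset (Fin m)), W.card < k →
      (E.onlineLoop score tie CR l R W).card ≤ k ∧
        (l.Nodup → Disjoint W l.toFinset → k ≤ W.card + l.length →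
          (E.onlineLoop score tie CR l R W).card = k)
  | [], R, W, hW => by
    simp only [onlineLoop, List.length_nil]
    exact ⟨hW.le, by omega⟩
  | c :: rest, R, W, hW => by
    rw [onlineLoop]
    dsimp only
    set W₁ := if ∃ d ∈ R \ E.mes score tie (insert c R), d ∈ CR then insert c W else W with hW₁
    generalize (if c ∈ E.mes score tie (insert c R) then
      insert c R \ (R \ E.mes score tie (insert c R)) else R) = R₁
    split_ifs with h1 h2
    · have h3 := List.toFinset_card_le (c :: rest)
      have h4 := Finset.card_union_le W (c :: rest).toFinset
      rw [List.length_cons] at h3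
      refine ⟨by omega, fun hnd hdisj _ => ?_⟩
      rw [Finset.card_union_of_disjoint hdisj, List.toFinset_card_of_nodup hnd, List.length_cons,
        h1]
    · exact ⟨h2.le, fun _ _ _ => h2⟩
    · have h3 : W₁ ⊆ insert c W := by
        rw [hW₁]
        split_ifs
        · exact subset_rfl
        · exact Finset.subset_insert _ _
      have h4 : W ⊆ W₁ := by
        rw [hW₁]
        split_ifs
        · exact Finset.subset_insert _ _
        · exact subset_rfl
      have h5 := (Finset.card_le_card h3).trans (Finset.card_insert_le c W)
      have h6 := Finset.card_le_card h4
      obtain ⟨h7, h8⟩ := card_onlineLoop E score tie CR rest R₁ W₁ (by omega)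
      refine ⟨h7, fun hnd hdisj hlen => h8 (List.nodup_cons.1 hnd).2 ?_ ?_⟩
      · refine Finset.disjoint_of_subset_left h3 ?_
        rw [List.toFinset_cons, Finset.disjoint_insert_right] at hdisj
        rw [Finset.disjoint_insert_left]
        exact ⟨by simpa using (List.nodup_cons.1 hnd).1, hdisj.2⟩
      -- The safeguard did not fire, so the inequality is strict and survives the loss of one
      -- arrival.
      · rw [List.length_cons] at hlen
        omega

theorem card_onlineMES (E : Election m n k) (score : Fin m → ℝ) (tie : Equiv.Perm (Fin m))
    (t : ℕ) (σ : Equiv.Perm (Fin m)) : (E.onlineMES score tie t σ).card ≤ k ∧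
      (t + k ≤ m → (E.onlineMES score tie t σ).card = k) := by
  have h := E.card_onlineLoop score tie (E.mes score tie ((List.ofFn σ).take t).toFinset)
    ((List.ofFn σ).drop t) (E.mes score tie ((List.ofFn σ).take t).toFinset) ∅
    (by have := E.two_le; simp; omega)
  refine ⟨h.1, fun ht => h.2 ?_ (Finset.disjoint_empty_left _) ?_⟩
  · exact (List.nodup_ofFn.2 σ.injective).sublist (List.drop_sublist _ _)
  · simp only [Finset.card_empty, List.length_drop, List.length_ofFn]
    omega

/-! ### Candidates that are certainly hired -/

theorem subset_onlineLoop (E : Election m n k) (score : Fin m → ℝ) (tie : Equiv.Perm (Fin m))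
    (CR : Finset (Fin m)) : ∀ (l : List (Fin m)) (R W : Finset (Fin m)),
      W ⊆ E.onlineLoop score tie CR l R W
  | [], R, W => by rw [onlineLoop]
  | c :: rest, R, W => by
    rw [onlineLoop]
    dsimp only
    have h : W ⊆ if ∃ d ∈ R \ E.mes score tie (insert c R), d ∈ CR then insert c W else W := by
      split_ifs
      · exact Finset.subset_insert _ _
      · exact subset_rfl
    set W₁ := if ∃ d ∈ R \ E.mes score tie (insert c R), d ∈ CR then insert c W else W
    generalize (if c ∈ E.mes score tie (insert c R) then
      insert c R \ (R \ E.mes score tie (insert c R)) else R) = R₁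
    split_ifs
    · exact Finset.subset_union_left
    · exact h
    · exact h.trans (subset_onlineLoop E score tie CR rest _ _)

section Loop

variable {β : Type*} [LinearOrder β]

/-- The running committee is always the top `k` of the candidates seen. Each hire evicts a reference
member, so hires plus surviving reference members never exceed `k`, and a seat stays free while `d`
survives. -/
theorem mem_onlineLoop {E : Election m n k} {score : Fin m → ℝ} {tie : Equiv.Perm (Fin m)}
    {r : Fin m → β} (hr : Function.Injective r) (hmes : ∀ X, E.mes score tie X = firstBy r k X)
    {CR : Finset (Fin m)} {c : Fin m} {l₂ : List (Fin m)} :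
    ∀ (l₁ : List (Fin m)) (Y W : Finset (Fin m)), CR ⊆ Y →
      (l₁ ++ c :: l₂).Nodup → Disjoint Y (l₁ ++ c :: l₂).toFinset →
      W.card + (firstBy r k Y ∩ CR).card ≤ k →
      (∃ d ∈ CR, d ∈ firstBy r k (Y ∪ l₁.toFinset) ∧
        d ∉ firstBy r k (insert c (Y ∪ l₁.toFinset))) →
      c ∈ E.onlineLoop score tie CR (l₁ ++ c :: l₂) (firstBy r k Y) W
  | [], Y, W, _, _, _, _, ⟨d, hd, hd₁, hd₂⟩ => by
    simp only [List.toFinset_nil, Finset.union_empty] at hd₁ hd₂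
    rw [List.nil_append, onlineLoop]
    have hhire : ∃ d ∈ firstBy r k Y \ E.mes score tie (insert c (firstBy r k Y)), d ∈ CR := by
      refine ⟨d, Finset.mem_sdiff.2 ⟨hd₁, ?_⟩, hd⟩
      rwa [hmes, firstBy_insert_firstBy hr]
    simp only [if_pos hhire]
    generalize (if c ∈ E.mes score tie (insert c (firstBy r k Y)) then
      insert c (firstBy r k Y) \ (firstBy r k Y \ E.mes score tie (insert c (firstBy r k Y)))
      else firstBy r k Y) = R₁
    split_ifs
    · simp
    · exact Finset.mem_insert_self _ _
    · exact E.subset_onlineLoop score tie CR _ _ _ (Finset.mem_insert_self c W)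
  | x :: l₁, Y, W, hCR, hnd, hdisj, hW, hd => by
    have hR : (if x ∈ E.mes score tie (insert x (firstBy r k Y)) then
        insert x (firstBy r k Y) \ (firstBy r k Y \ E.mes score tie (insert x (firstBy r k Y)))
        else firstBy r k Y) = firstBy r k (insert x Y) := by
      rw [hmes, firstBy_insert_firstBy hr]
      split_ifs with hx
      · ext y
        have hy : y ∈ firstBy r k (insert x Y) → y = x ∨ y ∈ firstBy r k Y := fun h =>
          (Finset.mem_insert.1 (firstBy_subset _ _ _ h)).imp id
            fun h' => mem_firstBy_of_subset (Finset.subset_insert _ _) h h'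
        have hyx : y = x → y ∈ firstBy r k (insert x Y) := fun h => h ▸ hx
        simp only [Finset.mem_sdiff, Finset.mem_insert]
        tauto
      · exact (firstBy_insert_of_notMem hr hx).symm
    have hsub : firstBy r k (insert x Y) ∩ CR ⊆ firstBy r k Y ∩ CR := by
      intro y hy
      rw [Finset.mem_inter] at hy ⊢
      exact ⟨mem_firstBy_of_subset (Finset.subset_insert _ _) hy.1 (hCR hy.2), hy.2⟩
    rw [List.cons_append] at hnd hdisj ⊢
    rw [onlineLoop]
    simp only [hR]
    set W₁ := if ∃ d ∈ firstBy r k Y \ E.mes score tie (insert x (firstBy r k Y)), d ∈ CR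
      then insert x W else W with hW₁
    have hcard : W₁.card + (firstBy r k (insert x Y) ∩ CR).card ≤ k := by
      rw [hW₁]
      split_ifs with hex
      · obtain ⟨y, hy, hyCR⟩ := hex
        rw [hmes, firstBy_insert_firstBy hr, Finset.mem_sdiff] at hy
        have h1 : (firstBy r k (insert x Y) ∩ CR).card < (firstBy r k Y ∩ CR).card := by
          apply Finset.card_lt_card
          rw [Finset.ssubset_iff_of_subset hsub]
          exact ⟨y, Finset.mem_inter.2 ⟨hy.1, hyCR⟩, fun h => hy.2 (Finset.mem_inter.1 h).1⟩
        have h2 := Finset.card_insert_le x W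
        omega
      · exact (Nat.add_le_add_left (Finset.card_le_card hsub) _).trans hW
    have hunion : Y ∪ (x :: l₁).toFinset = insert x Y ∪ l₁.toFinset := by
      rw [List.toFinset_cons, Finset.union_insert, Finset.insert_union]
    rw [hunion] at hd
    split_ifs with h1 h2
    · simp
    -- A full committee would leave no reference member, yet `d` is still in the running committee.
    · exfalso
      obtain ⟨d, hdCR, hd₁, -⟩ := hd
      have h3 : d ∈ firstBy r k (insert x Y) ∩ CR :=
        Finset.mem_inter.2 ⟨mem_firstBy_of_subset Finset.subset_union_left hd₁
          (Finset.mem_insert_of_mem (hCR hdCR)), hdCR⟩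
      have := Finset.card_pos.2 ⟨d, h3⟩
      omega
    · rw [List.nodup_cons] at hnd
      rw [List.toFinset_cons, Finset.disjoint_insert_right] at hdisj
      refine mem_onlineLoop hr hmes l₁ (insert x Y) W₁
        (hCR.trans (Finset.subset_insert _ _)) hnd.2 ?_ hcard hd
      rw [Finset.disjoint_insert_left]
      exact ⟨fun h => hnd.1 (List.mem_toFinset.1 h), hdisj.2⟩

theorem firstBy_univ_subset_onlineMES {E : Election m n k} {score : Fin m → ℝ}
    {tie : Equiv.Perm (Fin m)} {r : Fin m → β} (hr : Function.Injective r)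
    (hmes : ∀ X, E.mes score tie X = firstBy r k X) {t : ℕ} (hkt : k ≤ t) {σ : Equiv.Perm (Fin m)}
    {p q : List (Fin m)} (hσ : (List.ofFn σ).reverse = p ++ q) (hq : q.length = t)
    (hgood : RevGood r k q (firstBy r k Finset.univ) p) :
    firstBy r k Finset.univ ⊆ E.onlineMES score tie t σ := by
  intro c hc
  have hofFn : List.ofFn σ = q.reverse ++ p.reverse := by
    rw [← List.reverse_append, ← hσ, List.reverse_reverse]
  have hnd : (q.reverse ++ p.reverse).Nodup := hofFn ▸ List.nodup_ofFn.2 σ.injective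
  have huniv : (p ++ q).toFinset = Finset.univ := by
    ext x
    have : x ∈ (List.ofFn σ).reverse := by
      rw [List.mem_reverse, List.mem_ofFn]
      exact σ.surjective x
    rw [hσ] at this
    simpa using this
  obtain ⟨p₁, p₂, rfl, h⟩ := hgood.exists_append (by rw [huniv]) hc
  have htake : (List.ofFn σ).take t = q.reverse := by
    rw [hofFn, List.take_left' (by rw [List.length_reverse, hq])]
  have hdrop : (List.ofFn σ).drop t = p₂.reverse ++ c :: p₁.reverse := by
    rw [hofFn, List.drop_left' (by rw [List.length_reverse, hq])]
    simp
  rw [List.reverse_append, List.reverse_cons, List.append_assoc, List.singleton_append] at hnd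
  obtain ⟨hndq, hndp, hdis⟩ := List.nodup_append'.1 hnd
  have hset : (q.reverse.toFinset ∪ p₂.reverse.toFinset) = (p₂ ++ q).toFinset := by
    ext x
    simp [or_comm]
  simp only [onlineMES, htake, hdrop, hmes]
  refine mem_onlineLoop hr hmes p₂.reverse q.reverse.toFinset ∅ (firstBy_subset _ _ _) hndp ?_ ?_ ?_
  · rw [Finset.disjoint_left]
    intro x hx hx'
    exact hdis (List.mem_toFinset.1 hx) (List.mem_toFinset.1 hx')
  · rw [Finset.card_empty, zero_add, Finset.inter_self, card_firstBy hr]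
    exact min_le_left _ _
  · rw [hset]
    have hcnot : c ∉ (p₂ ++ q).toFinset := by
      intro hmem
      rw [List.mem_toFinset, List.mem_append] at hmem
      rcases hmem with hmem | hmem
      · exact (List.nodup_append'.1 hndp).2.2 (List.mem_reverse.2 hmem) (by simp)
      · exact hdis (List.mem_reverse.2 hmem) (by simp)
    have hcard : k ≤ (p₂ ++ q).toFinset.card := by
      calc k ≤ q.reverse.toFinset.card := by
            rw [List.toFinset_card_of_nodup hndq, List.length_reverse, hq]
            exact hkt
        _ ≤ _ := Finset.card_le_card (by rw [← hset]; exact Finset.subset_union_left)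
    obtain ⟨d, hd₁, hd₂⟩ := exists_mem_firstBy_notMem_insert hr hcard hcnot
      (mem_firstBy_of_subset (Finset.subset_univ _) hc (Finset.mem_insert_self _ _))
    have hdq := h d hd₁ hd₂
    -- A sampled candidate in the top `k` of a larger set is in the top `k` of the sample, hence a
    -- reference member.
    refine ⟨d, mem_firstBy_of_subset ?_ hd₁ (by simpa using hdq), hd₁, hd₂⟩
    rw [← hset]
    exact Finset.subset_union_left

end Loop

/-! ### Justified representation on single-approval instances -/

/-- Members value every `c ∈ T` with `α c > 0`, so single approval leaves at most one such `c`; as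
`T` is then nonempty, the group has at least `n / k` members, all supporting `c`. -/
theorem Cohesive.sum_eq_zero_or {E : Election m n k} (hE : E.SingleApproval) {α : Fin m → ℝ}
    {T : Finset (Fin m)} {S : Finset (Fin n)} (hα : ∀ c, 0 ≤ α c) (h : E.Cohesive α T S) :
    ∑ c ∈ T, α c = 0 ∨ ∃ c, E.WellSupported c ∧ ∀ i ∈ S, ∑ c ∈ T, α c ≤ E.u i c := by
  classical
  obtain ⟨⟨i₀, hi₀⟩, hcard, hu⟩ := h
  by_cases h0 : ∀ c ∈ T, α c = 0
  · exact Or.inl (Finset.sum_eq_zero h0)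
  right
  push Not at h0
  obtain ⟨c, hcT, hc⟩ := h0
  have hpos : 0 < α c := lt_of_le_of_ne (hα c) (Ne.symm hc)
  have hsum : ∑ d ∈ T, α d = α c := by
    refine Finset.sum_eq_single_of_mem c hcT fun d hd hdc => ?_
    refine le_antisymm (not_lt.1 fun hd' => hdc ?_) (hα d)
    exact hE i₀ d c (hd'.trans_le (hu i₀ hi₀ d hd)) (hpos.trans_le (hu i₀ hi₀ c hcT))
  refine ⟨c, ?_, fun i hi => hsum ▸ hu i hi c hcT⟩
  have hk : (0 : ℝ) < k := by
    have := E.two_le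
    exact_mod_cast (by omega : 0 < k)
  have hT : (1 : ℝ) ≤ T.card := by exact_mod_cast Finset.card_pos.2 ⟨c, hcT⟩
  have hS : (S.card : ℝ) ≤ ((Finset.univ.filter fun i => 0 < E.u i c).card : ℝ) := by
    exact_mod_cast Finset.card_le_card fun i hi =>
      Finset.mem_filter.2 ⟨Finset.mem_univ i, hpos.trans_le (hu i hi c hcT)⟩
  rw [WellSupported]
  calc (1 : ℝ) = 1 / k * k := by field_simp
    _ ≤ (S.card : ℝ) / n * k := by
      refine mul_le_mul_of_nonneg_right (le_trans ?_ hcard) hk.le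
      gcongr
    _ = (S.card : ℝ) * ((k : ℝ) / n) := by ring
    _ ≤ _ := by gcongr

theorem util_nonneg (E : Election m n k) (i : Fin n) (W : Finset (Fin m)) : 0 ≤ E.util i W :=
  Finset.sum_nonneg fun c _ => E.u_nonneg i c

theorem le_util (E : Election m n k) (i : Fin n) {W : Finset (Fin m)} {c : Fin m} (hc : c ∈ W) :
    E.u i c ≤ E.util i W :=
  Finset.single_le_sum (f := E.u i) (fun d _ => E.u_nonneg i d) hc

theorem ejr_of_wellSupported_mem {E : Election m n k} (hE : E.SingleApproval)
    {W : Finset (Fin m)} (hW : ∀ c, E.WellSupported c → c ∈ W) : E.EJR W := by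
  intro α T S hα h
  obtain ⟨i, hi⟩ := h.1
  refine ⟨i, hi, ?_⟩
  rcases h.sum_eq_zero_or hE hα with h0 | ⟨c, hc, hu⟩
  · exact h0 ▸ E.util_nonneg i W
  · exact (hu i hi).trans (E.le_util i (hW c hc))

theorem ejrUpTo_of_pos {E : Election m n k} (hE : E.SingleApproval) {p : ℕ} (hp : 0 < p)
    (W : Finset (Fin m)) : E.EJRUpTo p W := by
  intro α T S hα h
  obtain ⟨i, hi⟩ := h.1
  rcases h.sum_eq_zero_or hE hα with h0 | ⟨c, hc, hu⟩
  · exact ⟨i, hi, ∅, by simp, h0 ▸ E.util_nonneg i _⟩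
  · exact ⟨i, hi, {c}, by rwa [Finset.card_singleton], (hu i hi).trans (E.le_util i (by simp))⟩

theorem EJR.ejrUpTo {E : Election m n k} {W : Finset (Fin m)} (h : E.EJR W) (p : ℕ) :
    E.EJRUpTo p W := by
  intro α T S hα hS
  obtain ⟨i, hi, hle⟩ := h α T S hα hS
  exact ⟨i, hi, ∅, by simp, by simpa using hle⟩

theorem ejr_of_firstBy_subset {E : Election m n k} (hE : E.SingleApproval) {score : Fin m → ℝ}
    {tie : Equiv.Perm (Fin m)} {W : Finset (Fin m)}
    (hW : firstBy (E.mesKey score tie) k Finset.univ ⊆ W) : E.EJR W := by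
  classical
  refine ejr_of_wellSupported_mem hE fun c hc => hW ?_
  rw [← mes_eq_firstBy hE, mes, mesCore_eq hE]
  exact Finset.mem_union_left _ (by simpa using hc)

end Election

/-! ### Probabilities -/

theorem arrivalProb_mono {m : ℕ} {P Q : Equiv.Perm (Fin m) → Prop} (h : ∀ σ, P σ → Q σ) :
    arrivalProb m P ≤ arrivalProb m Q := by
  classical
  unfold arrivalProb
  gcongr
  exact h _

theorem arrivalProb_eq_one {m : ℕ} {P : Equiv.Perm (Fin m) → Prop} (h : ∀ σ, P σ) :
    arrivalProb m P = 1 := by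
  classical
  unfold arrivalProb
  rw [Finset.filter_true_of_mem fun σ _ => h σ, Finset.card_univ]
  exact div_self (by exact_mod_cast Fintype.card_ne_zero)

theorem exists_perm_ofFn_eq {m : ℕ} {l : List (Fin m)} (hnd : l.Nodup)
    (hl : l.toFinset = Finset.univ) : ∃ σ : Equiv.Perm (Fin m), List.ofFn σ = l := by
  have hlen : l.length = m := by
    rw [← List.toFinset_card_of_nodup hnd, hl, Finset.card_univ, Fintype.card_fin]
  have hinj : Function.Injective fun j : Fin m => l.get (Fin.cast hlen.symm j) :=
    hnd.injective_get.comp (Fin.cast_injective _)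
  refine ⟨Equiv.ofBijective _ (Finite.injective_iff_bijective.1 hinj), ?_⟩
  apply List.ext_get
  · simp [hlen]
  · intro j h1 h2
    simp

theorem le_arrivalProb_of_lists {m : ℕ} {P : Equiv.Perm (Fin m) → Prop}
    (L : Finset (List (Fin m))) (hL : ∀ l ∈ L, l.Nodup ∧ l.toFinset = Finset.univ)
    (hP : ∀ σ : Equiv.Perm (Fin m), (List.ofFn σ).reverse ∈ L → P σ) :
    (L.card : ℝ) / m.factorial ≤ arrivalProb m P := by
  classical
  rw [arrivalProb, Fintype.card_perm, Fintype.card_fin]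
  gcongr
  have hsub : L ⊆ (Finset.univ.filter P).image fun σ : Equiv.Perm (Fin m) => (List.ofFn σ).reverse := by
    intro l hl
    obtain ⟨hnd, hset⟩ := hL l hl
    obtain ⟨σ, hσ⟩ := exists_perm_ofFn_eq (List.nodup_reverse.2 hnd)
      (by rw [List.toFinset_reverse, hset])
    have hσ' : (List.ofFn σ).reverse = l := by rw [hσ, List.reverse_reverse]
    exact Finset.mem_image.2 ⟨σ, by simpa using hP σ (hσ' ▸ hl), hσ'⟩
  exact (Finset.card_le_card hsub).trans Finset.card_image_le

/-! ### The success probability and its limit -/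

theorem Election.le_arrivalProb_ejr {m n k : ℕ} {E : Election m n k} (hE : E.SingleApproval)
    (score : Fin m → ℝ) (tie : Equiv.Perm (Fin m)) (hm : 2 * (k : ℝ) ≤ (m : ℝ) / Real.exp 1) :
    (1 / Real.exp 1 - 2 * k / m) ^ k ≤
      arrivalProb m fun σ => E.EJR (E.onlineMES score tie ⌊(m : ℝ) / Real.exp 1⌋₊ σ) := by
  have hk := E.two_le
  have hm0 : (0 : ℝ) < m := by
    have := E.k_lt
    exact_mod_cast (by omega : 0 < m)
  have hexp : 0 < Real.exp 1 := Real.exp_pos 1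
  set t := ⌊(m : ℝ) / Real.exp 1⌋₊ with ht
  have htle : (t : ℝ) ≤ (m : ℝ) / Real.exp 1 := Nat.floor_le (by positivity)
  have hlt : (m : ℝ) / Real.exp 1 < t + 1 := Nat.lt_floor_add_one _
  have h2k : 2 * k ≤ t := Nat.le_floor (by exact_mod_cast hm)
  have htm : t ≤ m := by
    have : (t : ℝ) ≤ m := htle.trans (div_le_self hm0.le (Real.one_le_exp zero_le_one))
    exact_mod_cast this
  obtain ⟨s, hs⟩ : ∃ s, t = s + k := ⟨t - k, by omega⟩
  obtain ⟨d, hd⟩ : ∃ d, m = s + k + d := ⟨m - t, by omega⟩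
  have hr := E.mesKey_injective score tie
  obtain ⟨L, hL, hcard⟩ := exists_revGood_lists hr s k d Finset.univ
    (firstBy (E.mesKey score tie) k Finset.univ) (by rw [Finset.card_univ, Fintype.card_fin, hd])
    subset_rfl
  rw [card_firstBy hr, Finset.card_univ, Fintype.card_fin, min_eq_left E.k_lt.le] at hcard
  have hprob := le_arrivalProb_of_lists
    (P := fun σ => E.EJR (E.onlineMES score tie t σ)) L (fun l hl => ⟨(hL l hl).1, (hL l hl).2.1⟩)
    fun σ hσ => by
      obtain ⟨-, -, p, q, hpq, hq, hgood⟩ := hL _ hσ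
      exact ejr_of_firstBy_subset hE (firstBy_univ_subset_onlineMES hr (mes_eq_firstBy hE score tie)
        (by omega) hpq (hq.trans hs.symm) hgood)
  have hbound := le_orderBound_div (s := s) (k := k) (d := d) (by omega) (by omega) (by
    rw [← hd, ← le_div_iff₀ hexp]
    rw [hs] at htle
    exact_mod_cast htle)
  rw [← hd] at hbound
  have hst : (t : ℝ) = s + k := by exact_mod_cast hs
  calc (1 / Real.exp 1 - 2 * k / m) ^ k ≤ (((s : ℝ) + 1 - k) / m) ^ k := by
        -- Here `s + 1 - k = t + 1 - 2 * k`, and `t + 1` exceeds `m / e`.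
        refine pow_le_pow_left₀ ?_ ?_ k
        · rw [sub_nonneg, div_le_iff₀ hm0]
          calc 2 * (k : ℝ) ≤ _ := hm
            _ = _ := by ring
        · rw [le_div_iff₀ hm0, sub_mul, div_mul_cancel₀ _ hm0.ne', div_mul_eq_mul_div, one_mul]
          linarith
    _ ≤ orderBound s k d k / m.factorial := hbound
    _ ≤ L.card / m.factorial := by gcongr
    _ ≤ _ := hprob

theorem eventually_pow_sub_le (k : ℕ) {ε : ℝ} (hε : 0 < ε) :
    ∃ M : ℕ, ∀ m : ℕ, M ≤ m → 2 * (k : ℝ) ≤ (m : ℝ) / Real.exp 1 ∧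
      (1 / Real.exp 1) ^ k - ε ≤ (1 / Real.exp 1 - 2 * k / m) ^ k := by
  have h1 : Filter.Tendsto (fun m : ℕ => (m : ℝ) / Real.exp 1) Filter.atTop Filter.atTop :=
    tendsto_natCast_atTop_atTop.atTop_div_const (Real.exp_pos 1)
  have h2 : Filter.Tendsto (fun m : ℕ => (1 / Real.exp 1 - 2 * (k : ℝ) / m) ^ k) Filter.atTop
      (nhds ((1 / Real.exp 1 - 0) ^ k)) :=
    ((tendsto_const_div_atTop_nhds_zero_nat _).const_sub _).pow k
  rw [sub_zero] at h2
  exact Filter.eventually_atTop.1 ((h1.eventually_ge_atTop _).and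
    (h2.eventually_const_le (sub_lt_self _ hε)))

theorem Election.exists_forall_le_arrivalProb_ejr (k : ℕ) (ε : ℝ) (hε : 0 < ε) :
    ∃ M : ℕ, ∀ m : ℕ, M ≤ m → ∀ (n : ℕ) (E : Election m n k), E.SingleApproval →
      ∀ (score : Fin m → ℝ) (tie : Equiv.Perm (Fin m)),
        (1 / Real.exp 1) ^ k - ε ≤
          arrivalProb m fun σ =>
            E.EJR (E.onlineMES score tie ⌊(m : ℝ) / Real.exp 1⌋₊ σ) := by
  obtain ⟨M, hM⟩ := eventually_pow_sub_le k hε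
  exact ⟨M, fun m hm n E hE score tie =>
    (hM m hm).2.trans (E.le_arrivalProb_ejr hE score tie (hM m hm).1)⟩

theorem theorem5 :
    -- feasibility, on all instances, for all arrival orders and thresholds
    (∀ (m n k : ℕ) (E : Election m n k) (score : Fin m → ℝ) (tie : Equiv.Perm (Fin m))
        (t : ℕ) (σ : Equiv.Perm (Fin m)),
      (E.onlineMES score tie t σ).card ≤ k ∧
        (t + k ≤ m → (E.onlineMES score tie t σ).card = k)) ∧
    -- EJR up to `p` candidates on single-approval instances
    (∀ (k p : ℕ), p < k → ∀ ε : ℝ, 0 < ε → ∃ M : ℕ, ∀ m : ℕ, M ≤ m →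
      ∀ (n : ℕ) (E : Election m n k), E.SingleApproval →
      ∀ (score : Fin m → ℝ) (tie : Equiv.Perm (Fin m)),
        (1 / Real.exp 1) ^ (k - p) - ε ≤
          arrivalProb m fun σ =>
            E.EJRUpTo p (E.onlineMES score tie ⌊(m : ℝ) / Real.exp 1⌋₊ σ)) ∧
    -- full EJR on single-approval instances
    (∀ (k : ℕ) (ε : ℝ), 0 < ε → ∃ M : ℕ, ∀ m : ℕ, M ≤ m →
      ∀ (n : ℕ) (E : Election m n k), E.SingleApproval →
      ∀ (score : Fin m → ℝ) (tie : Equiv.Perm (Fin m)),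
        (1 / Real.exp 1) ^ k - ε ≤
          arrivalProb m fun σ =>
            E.EJR (E.onlineMES score tie ⌊(m : ℝ) / Real.exp 1⌋₊ σ)) := by
  refine ⟨fun m n k E score tie t σ => E.card_onlineMES score tie t σ, fun k p _ ε hε => ?_,
    Election.exists_forall_le_arrivalProb_ejr⟩
  rcases Nat.eq_zero_or_pos p with rfl | hp
  · obtain ⟨M, hM⟩ := Election.exists_forall_le_arrivalProb_ejr k ε hε
    exact ⟨M, fun m hm n E hE score tie => (hM m hm n E hE score tie).trans
      (arrivalProb_mono fun σ h => h.ejrUpTo 0)⟩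
  -- For `p ≥ 1` the property holds for every committee, so the probability is `1`.
  · refine ⟨0, fun m _ n E hE score tie => ?_⟩
    rw [arrivalProb_eq_one fun σ => Election.ejrUpTo_of_pos hE hp _]
    have h1 : (1 / Real.exp 1) ^ (k - p) ≤ 1 := by
      refine pow_le_one₀ (by positivity) ?_
      rw [div_le_one (Real.exp_pos 1)]
      exact Real.one_le_exp zero_le_one
    linarith
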